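/- Let $d\ge 1$ and let $\mathcal H=\mathbb C^d\otimes\mathbb C^d$ be a bipartite system. A state on a finite-dimensional Hilbert space $\mathcal K$ is a positive semidefinite operator of trace one; $\mathcal D(\mathcal K)$ is the set of states. Let $\phi_2=\frac12\sum_{i,j=0}^{1}|i,i\rangle\langle j,j|$ and, for a state $\rho$ on a finite-dimensional bipartite space $\mathcal H_A\otimes\mathcal H_B$, let $$F_2(\rho)=\sup_{A,B}\frac{\mathrm{tr}[(A\otimes B)^\dagger\rho(A\otimes B)\phi_2]}{\mathrm{tr}[(A\otimes B)^\dagger\rho(A\otimes B)]},$$ where the supremum is over all linear maps $A:\mathbb C^2\to\mathcal H_A$ and $B:\mathbb C^2\to\mathcal H_B$ for which the denominator is nonzero. The space $\mathcal H^{\otimes k}$ is regarded as bipartite, with all the first tensor factors $(\mathbb C^d)^{\otimes k}$ on one side and all the second ones on the other. A state $\rho$ is $n$-undistillable if $F_2(\rho^{\otimes n})=1/2$, and undistillable if it is $n$-undistillable for every integer $n\ge1$. Let $\mathcal C\subset\mathcal D(\mathcal H)$ be the set of undistillable states. For $k\ge1$ let $\mathcal T_k\subset\mathcal D(\mathcal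 H)$ be the set of copy-correlated $k$-undistillable states, that is, of the states $\rho=\mathrm{tr}_{\backslash 1}(\omega)$, the partial trace over all but the first copy of $\mathcal H$, where $\omega\in\mathcal D(\mathcal H^{\otimes k})$ is $1$-undistillable and satisfies $P_\pi\omega P_\pi^\dagger=\omega$ for every $\pi\in S_k$, with $P_\pi$ the unitary that permutes the $k$ copies of $\mathcal H$. For a set $S\subset\mathcal D(\mathcal H)$ let $$S^*=\{X=X^\dagger:\ \mathrm{tr}[X\rho]\ge 0\ \text{ for all }\rho\in S\}$$ be its dual cone. Then $$\mathcal C^*=\overline{\bigcup_{k\ge1}\mathcal T_k^*}.$$ -/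

import Mathlib

open scoped Kronecker Matrix ComplexOrder

namespace CopyCorrelated

/-- A state (density operator) on the finite-dimensional Hilbert space with orthonormal basis `ι`:
a positive semidefinite matrix of trace one. -/
def IsState {ι : Type*} [Fintype ι] (ρ : Matrix ι ι ℂ) : Prop :=
  ρ.PosSemidef ∧ ρ.trace = 1

/-- The projector onto the maximally entangled two-qubit state,
`φ₂ = (1/2) ∑ i j, |i,i⟩⟨j,j|`. -/
noncomputable def phi2 : Matrix (Fin 2 × Fin 2) (Fin 2 × Fin 2) ℂ :=
  Matrix.of fun p q => if p.1 = p.2 ∧ q.1 = q.2 then 1 / 2 else 0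

/-- The unnormalised two-qubit operator `(A ⊗ B)† ρ (A ⊗ B)`, for local filters
`A : ℂ² → ℂ^α` and `B : ℂ² → ℂ^β`. -/
noncomputable def localFilter {α β : Type*} [Fintype α] [Fintype β]
    (ρ : Matrix (α × β) (α × β) ℂ)
    (A : Matrix α (Fin 2) ℂ) (B : Matrix β (Fin 2) ℂ) :
    Matrix (Fin 2 × Fin 2) (Fin 2 × Fin 2) ℂ :=
  (A ⊗ₖ B)ᴴ * ρ * (A ⊗ₖ B)

/-- The SLOCC singlet fraction `F₂(ρ)`: the supremum of
`tr[(A ⊗ B)† ρ (A ⊗ B) φ₂] / tr[(A ⊗ B)† ρ (A ⊗ B)]` over all local filters `A`, `B` that succeed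
with nonzero probability. For a state `ρ` the set below is a nonempty subset of `[0, 1]`. -/
noncomputable def singletFraction {α β : Type*} [Fintype α] [Fintype β]
    (ρ : Matrix (α × β) (α × β) ℂ) : ℝ :=
  sSup {r : ℝ | ∃ (A : Matrix α (Fin 2) ℂ) (B : Matrix β (Fin 2) ℂ),
    (localFilter ρ A B).trace ≠ 0 ∧
      r = (localFilter ρ A B * phi2).trace.re / (localFilter ρ A B).trace.re}

/-- The `k`-fold tensor power `ρ^{⊗k}` of a bipartite operator, regarded as a bipartite operator
with all the first subsystems on one side and all the second subsystems on the other side. -/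
def tensorPower {α β : Type*} (ρ : Matrix (α × β) (α × β) ℂ) (k : ℕ) :
    Matrix ((Fin k → α) × (Fin k → β)) ((Fin k → α) × (Fin k → β)) ℂ :=
  Matrix.of fun p q => ∏ i, ρ (p.1 i, p.2 i) (q.1 i, q.2 i)

/-- The set `𝒞ₙ` of `n`-undistillable states. -/
def nUndistillable (α β : Type*) [Fintype α] [Fintype β] (n : ℕ) :
    Set (Matrix (α × β) (α × β) ℂ) :=
  {ρ | IsState ρ ∧ singletFraction (tensorPower ρ n) = 1 / 2}

/-- The set `𝒞` of undistillable states. -/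
def undistillable (α β : Type*) [Fintype α] [Fintype β] : Set (Matrix (α × β) (α × β) ℂ) :=
  {ρ | ∀ n : ℕ, 0 < n → ρ ∈ nUndistillable α β n}

/-- The action of a permutation of the `k` bipartite systems on the product basis: both halves
of each system are moved together. -/
def copyPerm (α β : Type*) {k : ℕ} (π : Equiv.Perm (Fin k)) :
    Equiv.Perm ((Fin k → α) × (Fin k → β)) :=
  Equiv.prodCongr (Equiv.arrowCongr π (Equiv.refl α)) (Equiv.arrowCongr π (Equiv.refl β))

/-- The unitary `P_π` on `ℋ^{⊗k}` that permutes the `k` bipartite systems. -/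
def permUnitary (α β : Type*) [DecidableEq α] [DecidableEq β] {k : ℕ} (π : Equiv.Perm (Fin k)) :
    Matrix ((Fin k → α) × (Fin k → β)) ((Fin k → α) × (Fin k → β)) ℂ :=
  Matrix.of fun p q => if p = copyPerm α β π q then 1 else 0

/-- Permutation symmetry: `P_π ω P_π† = ω` for every permutation `π` of the bipartite systems. -/
def IsPermSymmetric {α β : Type*} [Fintype α] [Fintype β] [DecidableEq α] [DecidableEq β] {k : ℕ}
    (ω : Matrix ((Fin k → α) × (Fin k → β)) ((Fin k → α) × (Fin k → β)) ℂ) : Prop :=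
  ∀ π : Equiv.Perm (Fin k), permUnitary α β π * ω * (permUnitary α β π)ᴴ = ω

/-- The partial trace `tr_{∖m}` over all the bipartite systems except the `m`-th one. -/
def reducedState {α β : Type*} [Fintype α] [Fintype β] [DecidableEq α] [DecidableEq β] {k : ℕ}
    (m : Fin k) (ω : Matrix ((Fin k → α) × (Fin k → β)) ((Fin k → α) × (Fin k → β)) ℂ) :
    Matrix (α × β) (α × β) ℂ :=
  Matrix.of fun p q => ∑ x : Fin k → α, ∑ y : Fin k → β,
    if x m = p.1 ∧ y m = p.2 then
      ω (x, y) (Function.update x m q.1, Function.update y m q.2)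
    else 0

/-- The set `𝒯ₖ` of copy-correlated `k`-undistillable states (`k ≥ 1`): the states that have a
permutation-symmetric, single-copy undistillable extension to `k` bipartite systems. -/
def copyCorrelatedUndistillable (α β : Type*) [Fintype α] [Fintype β] [DecidableEq α]
    [DecidableEq β] (k : ℕ) (hk : 0 < k) : Set (Matrix (α × β) (α × β) ℂ) :=
  {ρ | IsState ρ ∧
    ∃ ω : Matrix ((Fin k → α) × (Fin k → β)) ((Fin k → α) × (Fin k → β)) ℂ,
      IsState ω ∧ IsPermSymmetric ω ∧ ω ∈ nUndistillable (Fin k → α) (Fin k → β) 1 ∧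
        ρ = reducedState ⟨0, hk⟩ ω}

/-- The dual cone of a set of operators: the Hermitian operators `X` such that
`tr[X ρ] ≥ 0` for all `ρ` in the set. -/
def dualCone {ι : Type*} [Fintype ι] (S : Set (Matrix ι ι ℂ)) : Set (Matrix ι ι ℂ) :=
  {X | X.IsHermitian ∧ ∀ ρ ∈ S, 0 ≤ (X * ρ).trace.re}


end CopyCorrelated

/-!
For one inclusion, an undistillable `ρ` lies in every `𝒯ₖ`, witnessed by `ρ^{⊗k}`, so each `𝒯ₖ*` is
contained in the closed set `𝒞*`.

For the other one it is enough that for `X ∈ 𝒞*` and `ε > 0` the operator `X + ε` lies in some `𝒯ₖ*`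
(`exists_add_smul_one_mem_dualCone`). Otherwise there are, for every `k`, permutation-symmetric
undistillable states on `k` copies whose one-copy marginals `ρₖ` satisfy `tr[X ρₖ] < -ε`, and by
compactness there is an infinitely exchangeable family `ω` of states, `1`-undistillable for every
number of copies, with `tr[X ω₁] ≤ -ε`. The contradiction is a de Finetti argument that needs no
integral representation. The set `K` of all such families is compact (and sits in a locally convex
space), so the linear functional `ω ↦ tr[X ω₁]` attains its minimum over `K` at an extreme point of
`K`. Extreme points are families of powers of one state: for a product effect `A ⊗ B` both
`A ⊗ B` and its complement `s t - A ⊗ B = (s - A) ⊗ B + s ⊗ (t - B)` are separable, so measuring them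
on one copy amounts to mixing local filters and leads from `K` to the cone over `K`; this
decomposes `ω` inside that cone, and extremality makes the pieces proportional to `ω`
(`contract_eq_smul_of_mem_extremePoints`). Since product effects span all operators by
polarization, `ω` is multiplicative, that is `ωₙ = σ^{⊗n}` with `σ` undistillable
(`of_apply_singleton_mem_undistillable`), and `tr[X σ] ≥ 0` because `X ∈ 𝒞*`.

Throughout, undistillability is used as membership in a closed convex cone that is stable under local
filters (`undistillableCone`, `conj_kronecker_mem_undistillableCone`).
-/

namespace CopyCorrelated

open Finset Matrix

/-! ### Positive semidefinite matrices and polarization -/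

lemma norm_apply_le_trace_re {ι : Type*} [Fintype ι] {M : Matrix ι ι ℂ} (hM : M.PosSemidef)
    (i j : ι) : ‖M i j‖ ≤ M.trace.re := by
  classical
  have hd : ∀ k, 0 ≤ (M k k).re := fun k => (Complex.le_def.1 (hM.diag_nonneg (i := k))).1
  have him : ∀ k, (M k k).im = 0 := fun k => (Complex.le_def.1 (hM.diag_nonneg (i := k))).2.symm
  have hle : ∀ k, (M k k).re ≤ M.trace.re := fun k => by
    rw [Matrix.trace, Complex.re_sum]
    exact single_le_sum (f := fun k => (M k k).re) (fun k _ => hd k) (mem_univ k)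
  -- The `2 × 2` principal minor gives `|M i j|² ≤ M i i * M j j`.
  have h := (hM.submatrix ![i, j]).det_nonneg
  rw [Matrix.det_fin_two] at h
  have hji : M j i = star (M i j) := (hM.1.apply j i).symm
  simp only [submatrix_apply, cons_val_zero, cons_val_one, hji] at h
  have h2 := (Complex.le_def.1 h).1
  have h3 : (M i j * star (M i j)).re = ‖M i j‖ ^ 2 := by
    rw [Complex.star_def, Complex.mul_conj, Complex.normSq_eq_norm_sq, Complex.ofReal_re]
  rw [Complex.sub_re, h3, Complex.mul_re, him i, him j, Complex.zero_re] at h2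
  refine abs_le_of_sq_le_sq' ?_ ((hd i).trans (hle i)) |>.2
  nlinarith [hd i, hd j, hle i, hle j, mul_le_mul (hle i) (hle j) (hd j) ((hd i).trans (hle i))]

open scoped MatrixOrder Matrix.Norms.L2Operator in
lemma exists_eq_conjTranspose_mul_self {ι : Type*} [Fintype ι] {M : Matrix ι ι ℂ}
    (hM : M.PosSemidef) : ∃ R : Matrix ι ι ℂ, M = Rᴴ * R := by
  classical
  exact CStarAlgebra.nonneg_iff_eq_star_mul_self.mp hM.nonneg

open scoped MatrixOrder Matrix.Norms.L2Operator in
lemma exists_smul_one_sub_posSemidef {ι : Type*} [Fintype ι] [DecidableEq ι] {A : Matrix ι ι ℂ}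
    (hA : A.PosSemidef) : ∃ s : ℝ, 0 ≤ s ∧ (s • (1 : Matrix ι ι ℂ) - A).PosSemidef := by
  refine ⟨‖A‖, norm_nonneg _, ?_⟩
  rw [← Matrix.le_iff, ← Algebra.algebraMap_eq_smul_one]
  exact IsSelfAdjoint.le_algebraMap_norm_self hA.1

/-- Polarization: a linear functional on matrices is determined by its values on the operators
`|v⟩⟨v|`. -/
lemma apply_single_eq_zero_of_vecMulVec {ι : Type*} [DecidableEq ι] {f : Matrix ι ι ℂ → ℂ}
    (hadd : ∀ A B, f (A + B) = f A + f B) (hsmul : ∀ (c : ℂ) A, f (c • A) = c * f A)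
    (hf : ∀ v : ι → ℂ, f (vecMulVec v (star v)) = 0) (i j : ι) : f (single i j 1) = 0 := by
  have h : ∀ x y : ι → ℂ, (4 : ℂ) • vecMulVec x (star y) =
      vecMulVec (x + y) (star (x + y)) + (-1 : ℂ) • vecMulVec (x - y) (star (x - y)) +
        Complex.I • vecMulVec (x + Complex.I • y) (star (x + Complex.I • y)) +
          (-Complex.I) • vecMulVec (x - Complex.I • y) (star (x - Complex.I • y)) := by
    intro x y
    ext k l
    simp only [vecMulVec, Matrix.smul_apply, Matrix.add_apply, Matrix.of_apply, Pi.add_apply,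
      Pi.sub_apply, Pi.smul_apply, Pi.star_apply, star_add, star_sub, smul_eq_mul, star_mul',
      Complex.star_def, Complex.conj_I]
    linear_combination (2 * x k * (starRingEnd ℂ) (y l) - 2 * y k * (starRingEnd ℂ) (x l)) *
      Complex.I_mul_I
  have h4 := congrArg f (h (Pi.single i 1) (Pi.single j 1))
  rw [hadd, hadd, hadd, hsmul, hsmul, hsmul, hsmul, hf, hf, hf, hf] at h4
  have h1 : vecMulVec (Pi.single i 1) (star (Pi.single j 1 : ι → ℂ)) = single i j 1 := by
    rw [single_eq_single_vecMulVec_single, ← Pi.single_star, star_one]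
  rw [h1] at h4
  simpa using h4

/-! ### Unnormalised single-copy undistillable operators -/

/-- The closed convex cone of operators that are positive semidefinite and whose singlet fraction
does not exceed `1 / 2` under any local filter; the states in it are the `1`-undistillable ones.
The inequality is written without denominators, so that it also makes sense for filters that fail
with certainty and is linear in the operator. -/
def undistillableCone (α β : Type*) [Fintype α] [Fintype β] : Set (Matrix (α × β) (α × β) ℂ) :=
  {ρ | ρ.PosSemidef ∧ ∀ (A : Matrix α (Fin 2) ℂ) (B : Matrix β (Fin 2) ℂ),
    (localFilter ρ A B * phi2).trace.re ≤ (localFilter ρ A B).trace.re / 2}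

section Cone

variable {α β α' β' : Type*} [Fintype α] [Fintype β] [Fintype α'] [Fintype β']

lemma zero_mem_undistillableCone : (0 : Matrix (α × β) (α × β) ℂ) ∈ undistillableCone α β :=
  ⟨.zero, fun A B => by simp [localFilter]⟩

lemma add_mem_undistillableCone {M N : Matrix (α × β) (α × β) ℂ} (hM : M ∈ undistillableCone α β)
    (hN : N ∈ undistillableCone α β) : M + N ∈ undistillableCone α β := by
  refine ⟨hM.1.add hN.1, fun A B => ?_⟩
  have := add_le_add (hM.2 A B) (hN.2 A B)
  simp only [localFilter, Matrix.mul_add, Matrix.add_mul, trace_add, Complex.add_re] at this ⊢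
  linarith

lemma smul_mem_undistillableCone {M : Matrix (α × β) (α × β) ℂ} (hM : M ∈ undistillableCone α β)
    {r : ℝ} (hr : 0 ≤ r) : r • M ∈ undistillableCone α β := by
  refine ⟨hM.1.smul hr, fun A B => ?_⟩
  have := mul_le_mul_of_nonneg_left (hM.2 A B) hr
  simp only [localFilter, Matrix.mul_smul, Matrix.smul_mul, trace_smul, Complex.smul_re,
    smul_eq_mul] at this ⊢
  linarith

lemma sum_mem_undistillableCone {ι : Type*} (s : Finset ι) {M : ι → Matrix (α × β) (α × β) ℂ}
    (hM : ∀ i ∈ s, M i ∈ undistillableCone α β) : ∑ i ∈ s, M i ∈ undistillableCone α β :=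
  sum_induction M (· ∈ undistillableCone α β) (fun _ _ => add_mem_undistillableCone)
    zero_mem_undistillableCone hM

/-- Local filters do not create distillability: they can be absorbed into the filters over which
the singlet fraction is maximised. -/
lemma conj_kronecker_mem_undistillableCone {M : Matrix (α × β) (α × β) ℂ}
    (hM : M ∈ undistillableCone α β) (C : Matrix α α' ℂ) (D : Matrix β β' ℂ) :
    (C ⊗ₖ D)ᴴ * M * (C ⊗ₖ D) ∈ undistillableCone α' β' := by
  refine ⟨hM.1.conjTranspose_mul_mul_same _, fun A B => ?_⟩
  have h : localFilter ((C ⊗ₖ D)ᴴ * M * (C ⊗ₖ D)) A B = localFilter M (C * A) (D * B) := by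
    simp only [localFilter, mul_kronecker_mul, conjTranspose_mul, Matrix.mul_assoc]
  rw [h]
  exact hM.2 _ _

lemma submatrix_mem_undistillableCone {M : Matrix (α × β) (α × β) ℂ}
    (hM : M ∈ undistillableCone α β) (f : α' → α) (g : β' → β) :
    M.submatrix (Prod.map f g) (Prod.map f g) ∈ undistillableCone α' β' := by
  classical
  convert conj_kronecker_mem_undistillableCone hM ((1 : Matrix α α ℂ).submatrix id f)
    ((1 : Matrix β β ℂ).submatrix id g) using 1
  have h : ((1 : Matrix α α ℂ).submatrix id f) ⊗ₖ ((1 : Matrix β β ℂ).submatrix id g) =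
      (1 : Matrix (α × β) (α × β) ℂ).submatrix id (Prod.map f g) := by
    rw [← one_kronecker_one]
    rfl
  rw [h, conjTranspose_submatrix, conjTranspose_one]
  ext p q
  simp [Matrix.mul_apply, Matrix.one_apply]

lemma isClosed_undistillableCone : IsClosed (undistillableCone α β) := by
  have h : undistillableCone α β = {ρ | ρᴴ = ρ} ∩
      ((⋂ x : α × β → ℂ, {ρ | 0 ≤ star x ⬝ᵥ (ρ *ᵥ x)}) ∩
        ⋂ (A : Matrix α (Fin 2) ℂ) (B : Matrix β (Fin 2) ℂ),
          {ρ | (localFilter ρ A B * phi2).trace.re ≤ (localFilter ρ A B).trace.re / 2}) := by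
    ext ρ
    simp only [undistillableCone, Set.mem_ofPred_eq, Set.mem_inter_iff, Set.mem_iInter,
      posSemidef_iff_dotProduct_mulVec, and_assoc, Matrix.IsHermitian]
  rw [h]
  refine .inter (isClosed_eq (by fun_prop) continuous_id) (.inter (isClosed_iInter fun x =>
    isClosed_le (by fun_prop) (by fun_prop)) (isClosed_iInter fun A => isClosed_iInter fun B =>
      isClosed_le ?_ ?_))
  · unfold localFilter; fun_prop
  · unfold localFilter; fun_prop

end Cone

/-- A filter onto one product basis vector of nonzero weight leaves the pure product state
`|0,0⟩⟨0,0|`, whose overlap with `φ₂` is exactly `1 / 2`. -/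
lemma singletFraction_eq_half_iff {α β : Type*} [Fintype α] [Fintype β]
    {ρ : Matrix (α × β) (α × β) ℂ} (hρ : IsState ρ) :
    singletFraction ρ = 1 / 2 ↔ ρ ∈ undistillableCone α β := by
  classical
  have hL : ∀ A B, (localFilter ρ A B).PosSemidef := fun A B =>
    hρ.1.conjTranspose_mul_mul_same _
  have htr : ∀ A B, (localFilter ρ A B).trace ≠ 0 → 0 < (localFilter ρ A B).trace.re := by
    intro A B h
    have h0 := Complex.le_def.1 (hL A B).trace_nonneg
    refine lt_of_le_of_ne h0.1 fun h1 => h (Complex.ext h1.symm h0.2.symm)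
  have hphi : ∀ L : Matrix (Fin 2 × Fin 2) (Fin 2 × Fin 2) ℂ, (L * phi2).trace =
      (L (0, 0) (0, 0) + L (0, 0) (1, 1) + L (1, 1) (0, 0) + L (1, 1) (1, 1)) / 2 := by
    intro L
    simp only [Matrix.trace, Matrix.diag, Matrix.mul_apply, phi2, Matrix.of_apply,
      Fintype.sum_prod_type, Fin.sum_univ_two]
    simp
    ring
  have hbound : ∀ A B, (localFilter ρ A B * phi2).trace.re ≤ 2 * (localFilter ρ A B).trace.re := by
    intro A B
    have h := fun i j => (Complex.re_le_norm _).trans (norm_apply_le_trace_re (hL A B) i j)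
    rw [hphi, ← Nat.cast_ofNat (R := ℂ), Complex.div_natCast_re]
    simp only [Complex.add_re]
    have h1 := h (0, 0) (0, 0)
    have h2 := h (0, 0) (1, 1)
    have h3 := h (1, 1) (0, 0)
    have h4 := h (1, 1) (1, 1)
    push_cast
    linarith
  have hbdd : BddAbove {r : ℝ | ∃ (A : Matrix α (Fin 2) ℂ) (B : Matrix β (Fin 2) ℂ),
      (localFilter ρ A B).trace ≠ 0 ∧
        r = (localFilter ρ A B * phi2).trace.re / (localFilter ρ A B).trace.re} := by
    refine ⟨2, ?_⟩
    rintro r ⟨A, B, h, rfl⟩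
    rw [div_le_iff₀ (htr A B h)]
    exact hbound A B
  have hhalf : (1 / 2 : ℝ) ∈ {r : ℝ | ∃ (A : Matrix α (Fin 2) ℂ) (B : Matrix β (Fin 2) ℂ),
      (localFilter ρ A B).trace ≠ 0 ∧
        r = (localFilter ρ A B * phi2).trace.re / (localFilter ρ A B).trace.re} := by
    obtain ⟨⟨a, b⟩, hab⟩ : ∃ p, ρ p p ≠ 0 := by
      by_contra! h
      have := hρ.2
      simp [Matrix.trace, h] at this
    have hsingle : localFilter ρ (single a 0 1) (single b 0 1) =
        single (0, 0) (0, 0) (ρ (a, b) (a, b)) := by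
      rw [localFilter, single_kronecker_single, conjTranspose_single, single_mul_mul_single]
      simp
    refine ⟨single a 0 1, single b 0 1, ?_, ?_⟩
    · rw [hsingle, trace_single_eq_same]
      exact hab
    · have hpos := htr (single a 0 1) (single b 0 1)
      rw [hphi]
      rw [hsingle, trace_single_eq_same] at hpos ⊢
      rw [← Nat.cast_ofNat (R := ℂ), Complex.div_natCast_re]
      simp only [Complex.add_re]
      have := (hpos hab).ne'
      simp
      field_simp
  constructor
  · refine fun h => ⟨hρ.1, fun A B => ?_⟩
    by_cases h0 : (localFilter ρ A B).trace = 0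
    · rw [(hL A B).trace_eq_zero_iff.1 h0]
      simp
    · have := (le_csSup hbdd ⟨A, B, h0, rfl⟩).trans h.le
      rw [div_le_iff₀ (htr A B h0)] at this
      linarith
  · refine fun h => le_antisymm (csSup_le ⟨_, hhalf⟩ ?_) (le_csSup hbdd hhalf)
    rintro r ⟨A, B, h0, rfl⟩
    rw [div_le_iff₀ (htr A B h0)]
    linarith [h.2 A B]

/-! ### Tensor powers -/

section TensorPower

variable {α β : Type*} [Fintype α] [Fintype β]

lemma sum_prod_diag {κ : Type*} [Fintype κ] (n : ℕ) (f : κ → ℂ) :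
    ∑ z : Fin n → κ, ∏ i, f (z i) = (∑ a, f a) ^ n := by
  classical
  rw [← Fintype.piFinset_univ, ← Finset.prod_univ_sum]
  simp

lemma isState_tensorPower {ρ : Matrix (α × β) (α × β) ℂ} (hρ : IsState ρ) (n : ℕ) :
    IsState (tensorPower ρ n) := by
  classical
  constructor
  · obtain ⟨R, rfl⟩ := exists_eq_conjTranspose_mul_self hρ.1
    have h : tensorPower (Rᴴ * R) n = (tensorPower R n)ᴴ * tensorPower R n := by
      ext p q
      simp only [tensorPower, Matrix.of_apply, Matrix.mul_apply, Matrix.conjTranspose_apply,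
        star_prod, ← Finset.prod_mul_distrib]
      rw [Finset.prod_univ_sum, Fintype.piFinset_univ]
      exact Fintype.sum_equiv (Equiv.arrowProdEquivProdArrow _ _ _) _ _ fun _ => rfl
    rw [h]
    exact posSemidef_conjTranspose_mul_self _
  · have h : (tensorPower ρ n).trace = ∑ z : Fin n → α × β, ∏ i, ρ (z i) (z i) :=
      (Fintype.sum_equiv (Equiv.arrowProdEquivProdArrow _ _ _) _ _ fun _ => rfl).symm
    rw [h, sum_prod_diag n fun a => ρ a a]
    exact (congrArg (· ^ n) hρ.2).trans (one_pow n)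

lemma mem_nUndistillable_iff {ρ : Matrix (α × β) (α × β) ℂ} {n : ℕ} :
    ρ ∈ nUndistillable α β n ↔
      IsState ρ ∧ tensorPower ρ n ∈ undistillableCone (Fin n → α) (Fin n → β) :=
  and_congr_right fun h => singletFraction_eq_half_iff (isState_tensorPower h n)

lemma tensorPower_one_mem_undistillableCone_iff {ρ : Matrix (α × β) (α × β) ℂ} :
    tensorPower ρ 1 ∈ undistillableCone (Fin 1 → α) (Fin 1 → β) ↔
      ρ ∈ undistillableCone α β := by
  constructor <;> intro h
  · convert submatrix_mem_undistillableCone h (fun a _ => a) (fun b _ => b) using 1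
    ext p q
    simp [tensorPower]
  · convert submatrix_mem_undistillableCone h (fun x : Fin 1 → α => x 0)
      (fun y : Fin 1 → β => y 0) using 1
    ext p q
    simp [tensorPower, Prod.map]

end TensorPower

/-! ### Exchangeable families of operators -/

/-- The matrix entries of a sequence of permutation-symmetric operators, one for each number of
copies. A multiset of `n` letters `((i, j), (i', j'))` stands for the entry of the `n`-copy operator
whose row is given by the labels `(i, j)` and whose column is given by the labels `(i', j')`; using
multisets instead of lists builds the permutation symmetry into the type. -/
abbrev Family (α β : Type*) := Multiset ((α × β) × (α × β)) → ℂ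

/-- The multiset of letters that addresses the entry in row `p` and column `q`. -/
def word {α β : Type*} {n : ℕ} (p q : (Fin n → α) × (Fin n → β)) :
    Multiset ((α × β) × (α × β)) :=
  univ.val.map fun i => ((p.1 i, p.2 i), (q.1 i, q.2 i))

/-- The `n`-copy operator of a family. -/
def marginal {α β : Type*} (n : ℕ) (ω : Family α β) :
    Matrix ((Fin n → α) × (Fin n → β)) ((Fin n → α) × (Fin n → β)) ℂ :=
  Matrix.of fun p q => ω (word p q)

lemma univ_val_map_succ {κ : Type*} {n : ℕ} (f : Fin (n + 1) → κ) :
    univ.val.map f = f 0 ::ₘ univ.val.map fun i : Fin n => f i.succ := by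
  rw [Fin.univ_val_map, Fin.univ_val_map, List.ofFn_succ]
  rfl

lemma sum_fin_cons {κ : Type*} [Fintype κ] {n : ℕ} (f : (Fin (n + 1) → κ) → ℂ) :
    ∑ x, f x = ∑ a, ∑ z : Fin n → κ, f (Fin.cons a z) := by
  rw [← Fintype.sum_prod_type']
  exact (Fintype.sum_equiv (Fin.consEquiv fun _ => κ) _ _ fun _ => rfl).symm

lemma sum_pair_fin_cons {κ κ' : Type*} [Fintype κ] [Fintype κ'] {n : ℕ}
    (f : (Fin (n + 1) → κ) × (Fin (n + 1) → κ') → ℂ) :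
    ∑ x, f x = ∑ a : κ × κ', ∑ z : (Fin n → κ) × (Fin n → κ'),
      f (Fin.cons a.1 z.1, Fin.cons a.2 z.2) := by
  rw [Fintype.sum_prod_type, sum_fin_cons, Fintype.sum_prod_type]
  refine sum_congr rfl fun a _ => ?_
  simp_rw [sum_fin_cons, Fintype.sum_prod_type]
  exact Finset.sum_comm

lemma sum_sum_comm_sum_sum {κ₁ κ₂ κ₃ κ₄ : Type*} [Fintype κ₁] [Fintype κ₂] [Fintype κ₃]
    [Fintype κ₄] (G : κ₁ → κ₂ → κ₃ → κ₄ → ℂ) :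
    ∑ a, ∑ b, ∑ c, ∑ e, G a b c e = ∑ c, ∑ e, ∑ a, ∑ b, G a b c e := by
  calc
    _ = ∑ x : κ₁ × κ₂, ∑ y : κ₃ × κ₄, G x.1 x.2 y.1 y.2 := by simp only [Fintype.sum_prod_type]
    _ = ∑ y : κ₃ × κ₄, ∑ x : κ₁ × κ₂, G x.1 x.2 y.1 y.2 := Finset.sum_comm
    _ = _ := by simp only [Fintype.sum_prod_type]

lemma word_cons {α β : Type*} {n : ℕ} (a b : α × β) (p q : (Fin n → α) × (Fin n → β)) :
    word (n := n + 1) (Fin.cons a.1 p.1, Fin.cons a.2 p.2) (Fin.cons b.1 q.1, Fin.cons b.2 q.2) =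
      (a, b) ::ₘ word p q := by
  rw [word, univ_val_map_succ]
  rfl

section Families

variable {α β : Type*} [Fintype α] [Fintype β]

/-- The partial contraction of one copy of a family with an operator `E`: in terms of the `n`-copy
operators it sends `ω₍ₙ₊₁₎` to `tr₁[(E ⊗ 1) ω₍ₙ₊₁₎]`. -/
def contract (E : Matrix (α × β) (α × β) ℂ) (ω : Family α β) : Family α β :=
  fun m => ∑ a, ∑ b, E b a * ω ((a, b) ::ₘ m)

lemma contract_add_left (E F : Matrix (α × β) (α × β) ℂ) (ω : Family α β) :
    contract (E + F) ω = contract E ω + contract F ω := by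
  funext m
  simp [contract, add_mul, sum_add_distrib]

lemma contract_smul_left (c : ℂ) (E : Matrix (α × β) (α × β) ℂ) (ω : Family α β) :
    contract (c • E) ω = c • contract E ω := by
  funext m
  simp [contract, mul_sum, mul_assoc]

lemma contract_comm (E F : Matrix (α × β) (α × β) ℂ) (ω : Family α β) :
    contract E (contract F ω) = contract F (contract E ω) := by
  funext m
  simp only [contract, mul_sum]
  rw [sum_sum_comm_sum_sum]
  refine sum_congr rfl fun a _ => sum_congr rfl fun b _ => sum_congr rfl fun c _ =>
    sum_congr rfl fun e _ => ?_
  rw [Multiset.cons_swap]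
  ring

lemma contract_one [DecidableEq α] [DecidableEq β] (ω : Family α β)
    (m : Multiset ((α × β) × (α × β))) :
    contract 1 ω m = ∑ a, ω ((a, a) ::ₘ m) := by
  simp [contract, Matrix.one_apply]

lemma contract_single [DecidableEq α] [DecidableEq β] (a b : α × β) (ω : Family α β)
    (m : Multiset ((α × β) × (α × β))) :
    contract (single b a 1) ω m = ω ((a, b) ::ₘ m) := by
  simp [contract, Matrix.single_apply, ite_and]

lemma trace_mul_eq_contract (X : Matrix (α × β) (α × β) ℂ) (ω : Family α β) :
    (X * Matrix.of fun a b => ω {(a, b)}).trace = contract X ω 0 := by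
  simp only [Matrix.trace, Matrix.diag, Matrix.mul_apply, Matrix.of_apply, contract]
  exact Finset.sum_comm

lemma iterate_contract_one [DecidableEq α] [DecidableEq β] (j : ℕ) (ω : Family α β)
    (m : Multiset ((α × β) × (α × β))) :
    (contract 1)^[j] ω m =
      ∑ z : Fin j → α × β, ω (m + univ.val.map fun i => (z i, z i)) := by
  induction j generalizing m with
  | zero => simp
  | succ j ih =>
    rw [Function.iterate_succ_apply', contract_one, sum_fin_cons]
    refine sum_congr rfl fun a _ => ?_
    rw [ih]
    refine sum_congr rfl fun z _ => ?_
    rw [univ_val_map_succ, Multiset.cons_add, Multiset.add_cons]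
    rfl

lemma trace_marginal [DecidableEq α] [DecidableEq β] (n : ℕ) (ω : Family α β) :
    (marginal n ω).trace = (contract 1)^[n] ω 0 := by
  simp_rw [iterate_contract_one, zero_add]
  exact (Fintype.sum_equiv (Equiv.arrowProdEquivProdArrow _ _ _) _ _ fun _ => rfl).symm

/-- Contracting one copy with a product of positive semidefinite operators is a sum of local
filters, each projecting that copy onto a product vector, so it preserves the cone of
undistillable operators. -/
lemma marginal_contract_mem {ω : Family α β} {n : ℕ}
    (hω : marginal (n + 1) ω ∈ undistillableCone (Fin (n + 1) → α) (Fin (n + 1) → β))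
    {A : Matrix α α ℂ} {B : Matrix β β ℂ} (hA : A.PosSemidef) (hB : B.PosSemidef) :
    marginal n (contract (A ⊗ₖ B) ω) ∈ undistillableCone (Fin n → α) (Fin n → β) := by
  classical
  obtain ⟨R, rfl⟩ := exists_eq_conjTranspose_mul_self hA
  obtain ⟨S, rfl⟩ := exists_eq_conjTranspose_mul_self hB
  let C : α → Matrix (Fin (n + 1) → α) (Fin n → α) ℂ := fun k =>
    Matrix.of fun x p => if Fin.tail x = p then star (R k (x 0)) else 0
  let D : β → Matrix (Fin (n + 1) → β) (Fin n → β) ℂ := fun l =>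
    Matrix.of fun y p => if Fin.tail y = p then star (S l (y 0)) else 0
  have h : marginal n (contract ((Rᴴ * R) ⊗ₖ (Sᴴ * S)) ω) =
      ∑ k, ∑ l, (C k ⊗ₖ D l)ᴴ * marginal (n + 1) ω * (C k ⊗ₖ D l) := by
    have hCD : ∀ k l (a : α × β) (z p : (Fin n → α) × (Fin n → β)),
        (C k ⊗ₖ D l) (Fin.cons a.1 z.1, Fin.cons a.2 z.2) p =
          if z = p then star (R k a.1) * star (S l a.2) else 0 := fun k l a z p => by
      simp [C, D, Prod.ext_iff, ite_and]
      split_ifs <;> rfl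
    have hterm : ∀ k l p q, ((C k ⊗ₖ D l)ᴴ * marginal (n + 1) ω * (C k ⊗ₖ D l)) p q =
        ∑ a : α × β, ∑ b : α × β, star (R k b.1) * R k a.1 * (star (S l b.2) * S l a.2) *
          ω ((a, b) ::ₘ word p q) := fun k l p q => by
      rw [Finset.sum_comm]
      simp only [Matrix.mul_apply, sum_pair_fin_cons, conjTranspose_apply, hCD, marginal,
        Matrix.of_apply, word_cons]
      refine sum_congr rfl fun b _ => ?_
      rw [sum_eq_single q (fun z _ hz => by simp [hz]) (by simp), if_pos rfl, sum_mul]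
      refine sum_congr rfl fun a _ => ?_
      rw [sum_eq_single p (fun z _ hz => by simp [hz]) (by simp), if_pos rfl, star_mul',
        star_star, star_star]
      ring
    ext p q
    simp only [Matrix.sum_apply, hterm]
    rw [sum_sum_comm_sum_sum]
    refine sum_congr rfl fun a _ => sum_congr rfl fun b _ => ?_
    rw [kronecker_apply, Matrix.mul_apply, Matrix.mul_apply, sum_mul_sum, sum_mul]
    simp only [sum_mul, conjTranspose_apply]
  rw [h]
  exact sum_mem_undistillableCone _ fun k _ => sum_mem_undistillableCone _ fun l _ =>
    conj_kronecker_mem_undistillableCone hω _ _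

end Families

/-! ### The cone of exchangeable undistillable families -/

section Families

variable {α β : Type*} [Fintype α] [Fintype β]

lemma exists_word_eq {α β : Type*} (m : Multiset ((α × β) × (α × β))) :
    ∃ p q : (Fin m.card → α) × (Fin m.card → β), word p q = m := by
  induction m using Multiset.induction with
  | empty => exact ⟨⟨finZeroElim, finZeroElim⟩, ⟨finZeroElim, finZeroElim⟩, rfl⟩
  | cons a m ih =>
    obtain ⟨p, q, h⟩ := ih
    rw [Multiset.card_cons]
    exact ⟨_, _, (word_cons a.1 a.2 p q).trans (by rw [h])⟩

lemma card_word {α β : Type*} {n : ℕ} (p q : (Fin n → α) × (Fin n → β)) :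
    (word p q).card = n := by
  simp [word]

lemma norm_apply_le_of_marginal_mem [DecidableEq α] [DecidableEq β] {ω : Family α β}
    {m : Multiset ((α × β) × (α × β))}
    (h : marginal m.card ω ∈ undistillableCone (Fin m.card → α) (Fin m.card → β)) :
    ‖ω m‖ ≤ ((contract 1)^[m.card] ω 0).re := by
  obtain ⟨p, q, hpq⟩ := exists_word_eq m
  rw [← trace_marginal]
  convert norm_apply_le_trace_re h.1 p q
  rw [marginal, Matrix.of_apply, hpq]

lemma contract_add (E : Matrix (α × β) (α × β) ℂ) (ω η : Family α β) :
    contract E (ω + η) = contract E ω + contract E η := by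
  funext m
  simp [contract, mul_add, sum_add_distrib]

lemma contract_smul (E : Matrix (α × β) (α × β) ℂ) (r : ℝ) (ω : Family α β) :
    contract E (r • ω) = r • contract E ω := by
  funext m
  simp [contract, mul_sum, mul_left_comm]

lemma continuous_contract (E : Matrix (α × β) (α × β) ℂ) :
    Continuous (contract E : Family α β → Family α β) := by
  unfold contract
  fun_prop

variable [DecidableEq α] [DecidableEq β]

/-- The cone of infinitely exchangeable families whose `n`-copy operators are unnormalised
undistillable operators for every `n`, and are the partial traces of one another. -/
def exchangeableCone (α β : Type*) [Fintype α] [Fintype β] [DecidableEq α] [DecidableEq β] :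
    Set (Family α β) :=
  {ω | contract 1 ω = ω ∧ ∀ n, marginal n ω ∈ undistillableCone (Fin n → α) (Fin n → β)}

/-- The normalised families in the exchangeable cone: the value at the empty multiset is the common
trace of all the `n`-copy operators. -/
def exchangeableStates (α β : Type*) [Fintype α] [Fintype β] [DecidableEq α] [DecidableEq β] :
    Set (Family α β) :=
  {ω | ω 0 = 1 ∧ ω ∈ exchangeableCone α β}

lemma add_mem_exchangeableCone {ω η : Family α β} (hω : ω ∈ exchangeableCone α β)
    (hη : η ∈ exchangeableCone α β) : ω + η ∈ exchangeableCone α β :=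
  ⟨by rw [contract_add, hω.1, hη.1], fun n => add_mem_undistillableCone (hω.2 n) (hη.2 n)⟩

lemma smul_mem_exchangeableCone {ω : Family α β} (hω : ω ∈ exchangeableCone α β) {r : ℝ}
    (hr : 0 ≤ r) : r • ω ∈ exchangeableCone α β :=
  ⟨by rw [contract_smul, hω.1], fun n => smul_mem_undistillableCone (hω.2 n) hr⟩

lemma contract_mem_exchangeableCone {ω : Family α β} (hω : ω ∈ exchangeableCone α β)
    {A : Matrix α α ℂ} {B : Matrix β β ℂ} (hA : A.PosSemidef) (hB : B.PosSemidef) :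
    contract (A ⊗ₖ B) ω ∈ exchangeableCone α β :=
  ⟨by rw [contract_comm, hω.1], fun n => marginal_contract_mem (hω.2 (n + 1)) hA hB⟩

lemma apply_zero_nonneg {ω : Family α β} (hω : ω ∈ exchangeableCone α β) : 0 ≤ ω 0 := by
  have h := (hω.2 0).1.trace_nonneg
  rwa [trace_marginal] at h

lemma norm_apply_le_apply_zero {ω : Family α β} (hω : ω ∈ exchangeableCone α β)
    (m : Multiset ((α × β) × (α × β))) : ‖ω m‖ ≤ (ω 0).re := by
  have h := norm_apply_le_of_marginal_mem (hω.2 m.card)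
  rwa [Function.iterate_fixed hω.1] at h

/-! ### Compactness -/

lemma continuous_marginal {α β : Type*} (n : ℕ) :
    Continuous (marginal n : Family α β → _) :=
  continuous_matrix fun _ _ => continuous_apply _

lemma isClosed_exchangeableStates : IsClosed (exchangeableStates α β) := by
  have h : exchangeableStates α β = {ω | ω 0 = 1} ∩ ({ω | contract 1 ω = ω} ∩
      ⋂ n, marginal n ⁻¹' undistillableCone (Fin n → α) (Fin n → β)) := by
    ext ω
    simp [exchangeableStates, exchangeableCone]
  rw [h]
  exact (isClosed_eq (continuous_apply _) continuous_const).inter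
    ((isClosed_eq (continuous_contract 1) continuous_id).inter
      (isClosed_iInter fun n => isClosed_undistillableCone.preimage (continuous_marginal n)))

lemma isCompact_unitBox {κ : Type*} : IsCompact {f : κ → ℂ | ∀ m, ‖f m‖ ≤ 1} := by
  have h : {f : κ → ℂ | ∀ m, ‖f m‖ ≤ 1} = Set.univ.pi fun _ => Metric.closedBall 0 1 := by
    ext f
    simp
  rw [h]
  exact isCompact_univ_pi fun _ => isCompact_closedBall _ _

lemma isCompact_exchangeableStates : IsCompact (exchangeableStates α β) := by
  refine isCompact_unitBox.of_isClosed_subset isClosed_exchangeableStates fun ω hω m => ?_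
  simpa [hω.1] using norm_apply_le_apply_zero hω.2 m

/-! ### Extreme points are product families -/

/-- An extreme point `ω` that splits as a sum of two elements of the cone is proportional to each
of them. -/
lemma eq_smul_of_mem_extremePoints {ω u v : Family α β}
    (hω : ω ∈ Set.extremePoints ℝ (exchangeableStates α β)) (hu : u ∈ exchangeableCone α β)
    (hv : v ∈ exchangeableCone α β) {N : ℝ} (huv : u + v = N • ω) : u = u 0 • ω := by
  obtain ⟨⟨h0, hmem⟩, hext⟩ := hω
  -- Adding `ω` to both summands makes their traces positive, so that they can be normalised.
  have hu0 := Complex.le_def.1 (apply_zero_nonneg hu)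
  have hv0 := Complex.le_def.1 (apply_zero_nonneg hv)
  have hur : u 0 = ((u 0).re : ℂ) := Complex.ext rfl (by simpa using hu0.2.symm)
  have hvr : v 0 = ((v 0).re : ℂ) := Complex.ext rfl (by simpa using hv0.2.symm)
  simp only [Complex.zero_re] at hu0 hv0
  set a : ℝ := 1 + (u 0).re with ha
  set b : ℝ := 1 + (v 0).re with hb
  have hapos : 0 < a := by linarith [hu0.1]
  have hbpos : 0 < b := by linarith [hv0.1]
  have hN : a + b = N + 2 := by
    have := congrArg Complex.re (congrFun huv 0)
    simp [h0] at this
    linarith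
  have hy : a⁻¹ • (ω + u) ∈ exchangeableStates α β := by
    refine ⟨?_, smul_mem_exchangeableCone (add_mem_exchangeableCone hmem hu) (by positivity)⟩
    rw [Pi.smul_apply, Pi.add_apply, h0, hur, ← Complex.ofReal_one, ← Complex.ofReal_add, ← ha,
      Complex.real_smul, ← Complex.ofReal_mul, inv_mul_cancel₀ hapos.ne']
  have hz : b⁻¹ • (ω + v) ∈ exchangeableStates α β := by
    refine ⟨?_, smul_mem_exchangeableCone (add_mem_exchangeableCone hmem hv) (by positivity)⟩
    rw [Pi.smul_apply, Pi.add_apply, h0, hvr, ← Complex.ofReal_one, ← Complex.ofReal_add, ← hb,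
      Complex.real_smul, ← Complex.ofReal_mul, inv_mul_cancel₀ hbpos.ne']
  have hseg : ω ∈ openSegment ℝ (a⁻¹ • (ω + u)) (b⁻¹ • (ω + v)) := by
    refine ⟨a / (a + b), b / (a + b), by positivity, by positivity, by field_simp, ?_⟩
    rw [smul_smul, smul_smul, show a / (a + b) * a⁻¹ = (a + b)⁻¹ by field_simp,
      show b / (a + b) * b⁻¹ = (a + b)⁻¹ by field_simp, ← smul_add,
      show ω + u + (ω + v) = (a + b) • ω by
        rw [hN, add_smul, ← huv, two_smul]; abel, smul_smul, inv_mul_cancel₀ (by positivity),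
      one_smul]
  have heq : ω + u = a • ω := by
    have h := congrArg (a • ·) (hext hy hz hseg)
    simpa only [smul_smul, mul_inv_cancel₀ hapos.ne', one_smul] using h
  funext m
  have := congrFun heq m
  rw [hur]
  simp only [Pi.add_apply, Pi.smul_apply, ha, Complex.real_smul, Complex.ofReal_add,
    Complex.ofReal_one, smul_eq_mul] at this ⊢
  linear_combination this

/-- Measuring one copy of an extreme family with a product effect does not change the state of the
other copies. -/
lemma contract_eq_smul_of_mem_extremePoints {ω : Family α β}
    (hω : ω ∈ Set.extremePoints ℝ (exchangeableStates α β)) {A : Matrix α α ℂ} {B : Matrix β β ℂ}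
    (hA : A.PosSemidef) (hB : B.PosSemidef) :
    contract (A ⊗ₖ B) ω = contract (A ⊗ₖ B) ω 0 • ω := by
  obtain ⟨s, hs, hsA⟩ := exists_smul_one_sub_posSemidef hA
  obtain ⟨t, -, htB⟩ := exists_smul_one_sub_posSemidef hB
  have hmem := hω.1.2
  -- The complementary effect `s t - A ⊗ B = (s - A) ⊗ B + s ⊗ (t - B)` is separable too.
  refine eq_smul_of_mem_extremePoints hω (contract_mem_exchangeableCone hmem hA hB)
    (add_mem_exchangeableCone (contract_mem_exchangeableCone hmem hsA hB)
      (contract_mem_exchangeableCone hmem (Matrix.PosSemidef.one.smul hs) htB)) (N := s * t) ?_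
  have hE : A ⊗ₖ B + ((s • 1 - A) ⊗ₖ B + (s • (1 : Matrix α α ℂ)) ⊗ₖ (t • 1 - B)) =
      ((s * t : ℝ) : ℂ) • (1 : Matrix (α × β) (α × β) ℂ) := by
    rw [← one_kronecker_one]
    ext ⟨p₁, p₂⟩ ⟨q₁, q₂⟩
    simp only [Matrix.add_apply, Matrix.sub_apply, Matrix.smul_apply, kroneckerMap_apply,
      Complex.real_smul, smul_eq_mul, Complex.ofReal_mul]
    ring
  rw [← contract_add_left, ← contract_add_left, hE, contract_smul_left, hmem.1]
  funext m
  simp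

lemma apply_cons_of_mem_extremePoints {ω : Family α β}
    (hω : ω ∈ Set.extremePoints ℝ (exchangeableStates α β)) (a b : α × β)
    (m : Multiset ((α × β) × (α × β))) : ω ((a, b) ::ₘ m) = ω {(a, b)} * ω m := by
  let F : Matrix (α × β) (α × β) ℂ → ℂ := fun E => contract E ω m - contract E ω 0 * ω m
  have hadd : ∀ E E', F (E + E') = F E + F E' := fun E E' => by
    simp only [F, contract_add_left, Pi.add_apply]
    ring
  have hsmul : ∀ (c : ℂ) E, F (c • E) = c * F E := fun c E => by
    simp only [F, contract_smul_left, Pi.smul_apply, smul_eq_mul]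
    ring
  have hF : ∀ v w, F (vecMulVec v (star v) ⊗ₖ vecMulVec w (star w)) = 0 := fun v w => by
    have := congrFun (contract_eq_smul_of_mem_extremePoints hω (posSemidef_vecMulVec_self_star v)
      (posSemidef_vecMulVec_self_star w)) m
    simp only [F]
    rw [this, Pi.smul_apply, smul_eq_mul, sub_self]
  have hF₁ : ∀ w, F (single b.1 a.1 1 ⊗ₖ vecMulVec w (star w)) = 0 := fun w =>
    apply_single_eq_zero_of_vecMulVec (f := fun A => F (A ⊗ₖ vecMulVec w (star w)))
      (fun A A' => by rw [add_kronecker, hadd]) (fun c A => by rw [smul_kronecker, hsmul])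
      (fun v => hF v w) _ _
  have hF₂ : F (single b.1 a.1 1 ⊗ₖ single b.2 a.2 1) = 0 :=
    apply_single_eq_zero_of_vecMulVec (f := fun B => F (single b.1 a.1 1 ⊗ₖ B))
      (fun A A' => by rw [kronecker_add, hadd]) (fun c A => by rw [kronecker_smul, hsmul]) hF₁ _ _
  rw [single_kronecker_single, mul_one] at hF₂
  simp only [F] at hF₂
  rw [contract_single, contract_single] at hF₂
  exact sub_eq_zero.1 hF₂

/-- An extreme family consists of the tensor powers of its one-copy state, which is therefore
undistillable. -/
lemma of_apply_singleton_mem_undistillable {ω : Family α β}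
    (hω : ω ∈ Set.extremePoints ℝ (exchangeableStates α β)) :
    (Matrix.of fun a b => ω {(a, b)}) ∈ undistillable α β := by
  obtain ⟨⟨h0, hfix, hmem⟩, -⟩ := id hω
  have hprod : ∀ m, ω m = (m.map fun l => ω {l}).prod := fun m => by
    induction m using Multiset.induction with
    | empty => simpa using h0
    | cons l m ih =>
      rw [Multiset.map_cons, Multiset.prod_cons, ← ih]
      exact apply_cons_of_mem_extremePoints hω l.1 l.2 m
  have hpow : ∀ n, marginal n ω = tensorPower (Matrix.of fun a b => ω {(a, b)}) n := fun n => by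
    ext p q
    rw [marginal, Matrix.of_apply, hprod, word, Multiset.map_map]
    rfl
  refine fun n _ => mem_nUndistillable_iff.2 ⟨⟨?_, ?_⟩, hpow n ▸ hmem n⟩
  · exact (tensorPower_one_mem_undistillableCone_iff.1 (hpow 1 ▸ hmem 1)).1
  · have h : contract 1 ω 0 = ω 0 := congrFun hfix 0
    rw [contract_one, h0] at h
    exact h

end Families

/-! ### Families from permutation-symmetric operators on finitely many copies -/

lemma exists_perm_comp_eq_of_map_eq {κ : Type*} {n : ℕ} {f g : Fin n → κ}
    (h : univ.val.map f = univ.val.map g) : ∃ σ : Equiv.Perm (Fin n), g ∘ σ = f := by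
  classical
  have hcard : ∀ c, Fintype.card {a // f a = c} = Fintype.card {b // g b = c} := fun c => by
    have := congrArg (Multiset.count c) h
    rw [Multiset.count_map, Multiset.count_map] at this
    rw [Fintype.card_subtype, Fintype.card_subtype]
    simpa only [Finset.card, Finset.filter, eq_comm] using this
  exact ⟨Equiv.ofFiberEquiv fun c => Fintype.equivOfCardEq (hcard c),
    funext fun a => Equiv.ofFiberEquiv_map _ a⟩

section Families

variable {α β : Type*}

open Classical in
/-- The family whose only nonzero entries are those of the operator `Ω` on `k` copies. A multiset
determines its row and column only up to a common permutation of the copies, so this represents `Ω`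
when `Ω` is permutation symmetric (`marginal_ofOperator`). -/
noncomputable def ofOperator {k : ℕ}
    (Ω : Matrix ((Fin k → α) × (Fin k → β)) ((Fin k → α) × (Fin k → β)) ℂ) : Family α β :=
  fun m => if h : ∃ pq : ((Fin k → α) × (Fin k → β)) × ((Fin k → α) × (Fin k → β)),
    word pq.1 pq.2 = m then Ω h.choose.1 h.choose.2 else 0

variable [Fintype α] [Fintype β] [DecidableEq α] [DecidableEq β]

lemma permUnitary_conj_apply {k : ℕ} (π : Equiv.Perm (Fin k))
    (Ω : Matrix ((Fin k → α) × (Fin k → β)) ((Fin k → α) × (Fin k → β)) ℂ) (p q) :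
    (permUnitary α β π * Ω * (permUnitary α β π)ᴴ) (copyPerm α β π p) (copyPerm α β π q) =
      Ω p q := by
  simp [permUnitary, Matrix.mul_apply, Matrix.conjTranspose_apply]

lemma isPermSymmetric_iff {k : ℕ}
    {Ω : Matrix ((Fin k → α) × (Fin k → β)) ((Fin k → α) × (Fin k → β)) ℂ} :
    IsPermSymmetric Ω ↔ ∀ (π : Equiv.Perm (Fin k)) p q,
      Ω (copyPerm α β π p) (copyPerm α β π q) = Ω p q := by
  constructor
  · intro h π p q
    rw [← permUnitary_conj_apply π Ω p q, h π]
  · intro h π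
    ext p q
    obtain ⟨p, rfl⟩ := (copyPerm α β π).surjective p
    obtain ⟨q, rfl⟩ := (copyPerm α β π).surjective q
    rw [permUnitary_conj_apply, h]

lemma marginal_ofOperator {k : ℕ}
    {Ω : Matrix ((Fin k → α) × (Fin k → β)) ((Fin k → α) × (Fin k → β)) ℂ}
    (hΩ : IsPermSymmetric Ω) : marginal k (ofOperator Ω) = Ω := by
  ext p q
  have h : ∃ pq : ((Fin k → α) × (Fin k → β)) × ((Fin k → α) × (Fin k → β)),
    word pq.1 pq.2 = word p q := ⟨(p, q), rfl⟩
  rw [marginal, Matrix.of_apply, ofOperator, dif_pos h]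
  obtain ⟨σ, hσ⟩ := exists_perm_comp_eq_of_map_eq h.choose_spec
  have hi : ∀ i, _ := fun i => congrFun hσ (σ.symm i)
  simp only [Function.comp_apply, Equiv.apply_symm_apply, Prod.mk.injEq] at hi
  rw [← isPermSymmetric_iff.1 hΩ σ]
  congr 1
  · exact Prod.ext (funext fun i => (hi i).1.1.symm) (funext fun i => (hi i).1.2.symm)
  · exact Prod.ext (funext fun i => (hi i).2.1.symm) (funext fun i => (hi i).2.2.symm)

/-- The family of all partial traces of a permutation-symmetric operator on `k` copies; the entries
that would belong to more than `k` copies are set to zero. -/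
noncomputable def partialTraces {k : ℕ}
    (Ω : Matrix ((Fin k → α) × (Fin k → β)) ((Fin k → α) × (Fin k → β)) ℂ) : Family α β :=
  fun m => if m.card ≤ k then (contract 1)^[k - m.card] (ofOperator Ω) m else 0

lemma reducedState_zero_apply {j : ℕ} (hj : 0 < j + 1)
    (Ω : Matrix ((Fin (j + 1) → α) × (Fin (j + 1) → β)) ((Fin (j + 1) → α) × (Fin (j + 1) → β)) ℂ)
    (p q : α × β) : reducedState ⟨0, hj⟩ Ω p q = ∑ z : (Fin j → α) × (Fin j → β),
      Ω (Fin.cons p.1 z.1, Fin.cons p.2 z.2) (Fin.cons q.1 z.1, Fin.cons q.2 z.2) := by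
  rw [reducedState, Matrix.of_apply, ← Fintype.sum_prod_type', sum_pair_fin_cons]
  rw [sum_eq_single p]
  · simp [Fin.update_cons_zero]
  · intro a _ ha
    refine sum_eq_zero fun z _ => if_neg fun h => ha (Prod.ext h.1 h.2)
  · simp

/-- The exchangeable families on at most `k` copies, normalised, with all their operators up to `k`
copies undistillable. The entries that belong to more than `k` copies are only required to be
bounded, which makes these sets compact and decreasing in `k`. -/
def truncatedStates (α β : Type*) [Fintype α] [Fintype β] [DecidableEq α] [DecidableEq β] (k : ℕ) :
    Set (Family α β) :=
  {ω | ω 0 = 1 ∧ (∀ m, ‖ω m‖ ≤ 1) ∧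
    (∀ m : Multiset ((α × β) × (α × β)), m.card < k → contract 1 ω m = ω m) ∧
    ∀ n ≤ k, marginal n ω ∈ undistillableCone (Fin n → α) (Fin n → β)}

lemma marginal_iterate_contract_one_mem {ω : Family α β} {k : ℕ}
    (hω : marginal k ω ∈ undistillableCone (Fin k → α) (Fin k → β)) {n : ℕ} (hn : n ≤ k) :
    marginal n ((contract 1)^[k - n] ω) ∈ undistillableCone (Fin n → α) (Fin n → β) := by
  induction hn using Nat.decreasingInduction with
  | self => simpa using hω
  | of_succ n hn ih =>
    rw [show k - n = (k - (n + 1)) + 1 by omega, Function.iterate_succ_apply']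
    have h := marginal_contract_mem ih (Matrix.PosSemidef.one (n := α) (R := ℂ))
      (Matrix.PosSemidef.one (n := β) (R := ℂ))
    rwa [one_kronecker_one] at h

lemma partialTraces_mem_truncatedStates {k : ℕ}
    {Ω : Matrix ((Fin k → α) × (Fin k → β)) ((Fin k → α) × (Fin k → β)) ℂ}
    (hΩ : IsState Ω) (hsymm : IsPermSymmetric Ω)
    (hmem : Ω ∈ undistillableCone (Fin k → α) (Fin k → β)) :
    partialTraces Ω ∈ truncatedStates α β k := by
  have hmarg : ∀ n ≤ k, marginal n (partialTraces Ω) =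
      marginal n ((contract 1)^[k - n] (ofOperator Ω)) := fun n hn => by
    ext p q
    simp [marginal, partialTraces, card_word, hn]
  have hcone : ∀ n ≤ k, marginal n ((contract 1)^[k - n] (ofOperator Ω)) ∈
      undistillableCone (Fin n → α) (Fin n → β) := fun n hn =>
    marginal_iterate_contract_one_mem (by rwa [marginal_ofOperator hsymm]) hn
  have htr : (contract 1)^[k] (ofOperator Ω) 0 = 1 := by
    rw [← trace_marginal, marginal_ofOperator hsymm, hΩ.2]
  refine ⟨by simpa [partialTraces] using htr, fun m => ?_, fun m hm => ?_, fun n hn => ?_⟩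
  · by_cases hm : m.card ≤ k
    · have h := norm_apply_le_of_marginal_mem (hcone _ hm)
      rw [← Function.iterate_add_apply, Nat.add_sub_cancel' hm, htr] at h
      simpa [partialTraces, hm] using h
    · simp [partialTraces, hm]
  · rw [contract_one]
    simp only [partialTraces, Multiset.card_cons, if_pos hm.le, if_pos (Nat.succ_le_of_lt hm)]
    rw [show k - m.card = (k - (m.card + 1)) + 1 by omega, Function.iterate_succ_apply',
      contract_one]
  · rw [hmarg n hn]
    exact hcone n hn

lemma reducedState_eq_partialTraces {k : ℕ} (hk : 0 < k)
    {Ω : Matrix ((Fin k → α) × (Fin k → β)) ((Fin k → α) × (Fin k → β)) ℂ}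
    (hsymm : IsPermSymmetric Ω) (p q : α × β) :
    reducedState ⟨0, hk⟩ Ω p q = partialTraces Ω {(p, q)} := by
  obtain ⟨j, rfl⟩ : ∃ j, k = j + 1 := ⟨k - 1, by omega⟩
  rw [reducedState_zero_apply, partialTraces, if_pos (by simp), Multiset.card_singleton,
    Nat.add_sub_cancel, iterate_contract_one]
  refine (Fintype.sum_equiv (Equiv.arrowProdEquivProdArrow _ _ _) _ _ fun z => ?_).symm
  conv_rhs => rw [← marginal_ofOperator hsymm]
  rw [marginal, Matrix.of_apply, word_cons]
  rfl

lemma isClosed_truncatedStates (k : ℕ) : IsClosed (truncatedStates α β k) := by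
  have h : truncatedStates α β k = {ω | ω 0 = 1} ∩ ({ω | ∀ m, ‖ω m‖ ≤ 1} ∩
      ((⋂ (m : Multiset ((α × β) × (α × β))) (_ : m.card < k), {ω | contract 1 ω m = ω m}) ∩
        ⋂ (n : ℕ) (_ : n ≤ k), marginal n ⁻¹' undistillableCone (Fin n → α) (Fin n → β))) := by
    ext ω
    simp [truncatedStates]
  rw [h]
  exact (isClosed_eq (continuous_apply _) continuous_const).inter
    (isCompact_unitBox.isClosed.inter
      ((isClosed_biInter fun m _ => isClosed_eq ((continuous_apply m).comp (continuous_contract 1))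
        (continuous_apply m)).inter (isClosed_biInter fun n _ =>
          isClosed_undistillableCone.preimage (continuous_marginal n))))

/-! ### The two inclusions -/

/-- The minimum of a linear functional over the compact set of exchangeable families is attained at
an extreme point, which is a family of powers of an undistillable state. -/
lemma re_contract_nonneg {X : Matrix (α × β) (α × β) ℂ} (hX : X ∈ dualCone (undistillable α β))
    {ω : Family α β} (hω : ω ∈ exchangeableStates α β) : 0 ≤ (contract X ω 0).re := by
  let l : Family α β →L[ℝ] ℝ :=
    { toFun := fun η => -(contract X η 0).re
      map_add' := fun η η' => by simp [contract_add, add_comm]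
      map_smul' := fun r η => by simp [contract_smul]
      cont := (Complex.continuous_re.comp
        ((continuous_apply 0).comp (continuous_contract X))).neg }
  have hface : IsExposed ℝ (exchangeableStates α β) (l.toExposed (exchangeableStates α β)) :=
    ContinuousLinearMap.toExposed.isExposed
  obtain ⟨η₀, hη₀, hmax⟩ := isCompact_exchangeableStates.exists_isMaxOn ⟨ω, hω⟩
    l.continuous.continuousOn
  obtain ⟨η, hη⟩ := (hface.isCompact isCompact_exchangeableStates).extremePoints_nonempty
    ⟨η₀, hη₀, fun y hy => hmax hy⟩
  have h1 := hX.2 _ (of_apply_singleton_mem_undistillable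
    (hface.isExtreme.extremePoints_subset_extremePoints hη))
  rw [trace_mul_eq_contract] at h1
  have h2 : -(contract X ω 0).re ≤ -(contract X η 0).re := hη.1.2 ω hω
  linarith

lemma exists_add_smul_one_mem_dualCone {X : Matrix (α × β) (α × β) ℂ}
    (hX : X ∈ dualCone (undistillable α β)) {ε : ℝ} (hε : 0 < ε) :
    ∃ (k : ℕ) (hk : 0 < k), X + ε • (1 : Matrix (α × β) (α × β) ℂ) ∈
      dualCone (copyCorrelatedUndistillable α β k hk) := by
  by_contra! hcon
  let t : ℕ → Set (Family α β) := fun k =>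
    truncatedStates α β (k + 1) ∩ {ω | (contract X ω 0).re ≤ -ε}
  have hclosed : ∀ k, IsClosed (t k) := fun k => (isClosed_truncatedStates _).inter
    (isClosed_le (Complex.continuous_re.comp
      ((continuous_apply 0).comp (continuous_contract X))) continuous_const)
  have hne : ∀ k, (t k).Nonempty := fun k => by
    have hherm : (X + ε • (1 : Matrix (α × β) (α × β) ℂ)).IsHermitian :=
      hX.1.add (Matrix.PosSemidef.one.smul hε.le).1
    have h := hcon (k + 1) k.succ_pos
    simp only [dualCone, Set.mem_ofPred_eq, not_and, not_forall, not_le] at h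
    obtain ⟨ρ, ⟨hρ, Ω, hΩ, hsymm, hund, rfl⟩, hlt⟩ := h hherm
    refine ⟨partialTraces Ω, partialTraces_mem_truncatedStates hΩ hsymm
      (tensorPower_one_mem_undistillableCone_iff.1 (mem_nUndistillable_iff.1 hund).2), ?_⟩
    have hred : reducedState ⟨0, k.succ_pos⟩ Ω =
        Matrix.of fun a b => partialTraces Ω {(a, b)} := by
      ext a b
      exact reducedState_eq_partialTraces _ hsymm a b
    rw [Matrix.add_mul, trace_add, Matrix.smul_mul, Matrix.one_mul, trace_smul, hρ.2, hred,
      trace_mul_eq_contract] at hlt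
    simp only [Complex.add_re, Complex.smul_re, Complex.one_re, smul_eq_mul, mul_one] at hlt
    simp only [Set.mem_ofPred_eq]
    linarith
  obtain ⟨ω, hω⟩ := IsCompact.nonempty_iInter_of_sequence_nonempty_isCompact_isClosed t
    (fun k ω h => ⟨⟨h.1.1, h.1.2.1, fun m hm => h.1.2.2.1 m (by omega),
      fun n hn => h.1.2.2.2 n (by omega)⟩, h.2⟩) hne
    (isCompact_unitBox.of_isClosed_subset (hclosed 0) fun ω h => h.1.2.1) hclosed
  rw [Set.mem_iInter] at hω
  have hmem : ω ∈ exchangeableStates α β :=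
    ⟨(hω 0).1.1, funext fun m => (hω m.card).1.2.2.1 m (by omega),
      fun n => (hω n).1.2.2.2 n (by omega)⟩
  have h1 := re_contract_nonneg hX hmem
  have h2 : (contract X ω 0).re ≤ -ε := (hω 0).2
  linarith

lemma undistillable_subset_copyCorrelatedUndistillable (k : ℕ) (hk : 0 < k) :
    undistillable α β ⊆ copyCorrelatedUndistillable α β k hk := by
  intro ρ hρ
  obtain ⟨hstate, hmem⟩ := mem_nUndistillable_iff.1 (hρ k hk)
  refine ⟨hstate, tensorPower ρ k, isState_tensorPower hstate k, ?_,
    mem_nUndistillable_iff.2 ⟨isState_tensorPower hstate k,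
      tensorPower_one_mem_undistillableCone_iff.2 hmem⟩, ?_⟩
  · refine isPermSymmetric_iff.2 fun π p q => ?_
    exact Equiv.prod_comp π.symm fun i => ρ (p.1 i, p.2 i) (q.1 i, q.2 i)
  · obtain ⟨j, rfl⟩ : ∃ j, k = j + 1 := ⟨k - 1, by omega⟩
    ext p q
    have h : ∀ z : (Fin j → α) × (Fin j → β), tensorPower ρ (j + 1)
        (Fin.cons p.1 z.1, Fin.cons p.2 z.2) (Fin.cons q.1 z.1, Fin.cons q.2 z.2) =
          ρ p q * tensorPower ρ j z z := fun z => by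
      simp [tensorPower, Fin.prod_univ_succ]
    simp_rw [reducedState_zero_apply, h, ← mul_sum]
    have htr := (isState_tensorPower hstate j).2
    rw [Matrix.trace] at htr
    simp only [Matrix.diag] at htr
    rw [htr, mul_one]

lemma isClosed_dualCone {ι : Type*} [Fintype ι] (S : Set (Matrix ι ι ℂ)) :
    IsClosed (dualCone S) := by
  have h : dualCone S = {X | Xᴴ = X} ∩ ⋂ ρ ∈ S, {X | 0 ≤ (X * ρ).trace.re} := by
    ext X
    simp [dualCone, Matrix.IsHermitian]
  rw [h]
  exact (isClosed_eq (by fun_prop) continuous_id).inter (isClosed_biInter fun ρ _ =>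
    isClosed_le continuous_const (by fun_prop))

end Families

end CopyCorrelated

/-- The dual cone of the set of undistillable states of a `d × d` system is the closure of the union
of the dual cones of the sets of copy-correlated `k`-undistillable states, `k ≥ 1`. -/
theorem corollary1 (d : ℕ) :
    CopyCorrelated.dualCone (CopyCorrelated.undistillable (Fin d) (Fin d)) =
      closure (⋃ (k : ℕ) (hk : 0 < k),
        CopyCorrelated.dualCone
          (CopyCorrelated.copyCorrelatedUndistillable (Fin d) (Fin d) k hk)) := by
  open CopyCorrelated in
  apply Set.Subset.antisymm
  · intro X hX
    have hlim : Filter.Tendsto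
        (fun n : ℕ => X + (1 / ((n : ℝ) + 1)) • (1 : Matrix (Fin d × Fin d) (Fin d × Fin d) ℂ))
        Filter.atTop (nhds X) := by
      have h := (tendsto_one_div_add_atTop_nhds_zero_nat (𝕜 := ℝ)).smul_const
        (1 : Matrix (Fin d × Fin d) (Fin d × Fin d) ℂ)
      simpa using h.const_add X
    refine mem_closure_of_tendsto hlim (Filter.Eventually.of_forall fun n => ?_)
    obtain ⟨k, hk, h⟩ := exists_add_smul_one_mem_dualCone hX
      (show (0 : ℝ) < 1 / ((n : ℝ) + 1) by positivity)
    exact Set.mem_iUnion₂.2 ⟨k, hk, h⟩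
  · refine closure_minimal (Set.iUnion₂_subset fun k hk X hX => ⟨hX.1, fun ρ hρ => ?_⟩)
      (isClosed_dualCone _)
    exact hX.2 ρ (undistillable_subset_copyCorrelatedUndistillable k hk hρ)
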